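/- Let $p$ be a prime with $p\equiv 1\pmod 3$ such that $2$ is a cubic residue modulo $p$, i.e. $2\equiv x^3 \pmod p$ for some integer $x$. For $\ell\ge 1$ let $\Gamma(3,p^{3\ell})$ be the graph whose vertices are the elements of the field $\mathbb{F}_{p^{3\ell}}$, with an edge from $v$ to $w$ if and only if $w-v$ is a nonzero cube in $\mathbb{F}_{p^{3\ell}}$. The spectrum of a graph is the multiset of the eigenvalues of its adjacency matrix; we write $\mathrm{Spec}\,\Gamma=\{[\lambda_1]^{e_1},\dots,[\lambda_s]^{e_s}\}$ if the distinct eigenvalues are $\lambda_1,\dots,\lambda_s$, with multiplicities $e_1,\dots,e_s$. For $\ell\ge1$ and numbers $a,b$ put $n_\ell=\frac{p^{3\ell}-1}{3}$ and $$S_\ell(a,b)=\Big\{[n_\ell]^1,\ \big[\tfrac{a p^{\ell}-1}{3}\big]^{n_\ell},\ \big[\tfrac{-\frac12(a+9b)p^{\ell}-1}{3}\big]^{n_\ell},\ \big[\tfrac{-\frac12(a-9b)p^{\ell}-1}{3}\big]^{n_\ell}\Big\}.$$ 1. There are integers $x_0,y_0$ with $p=x_0^2+27y_0^2$, $(x_0,p)=1$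 and $x_0\equiv 1\pmod 3$, and for any such $x_0,y_0$ and every integer $\ell\ge 1$ we have $\mathrm{Spec}\,\Gamma(3,p^{3\ell})=S_\ell(a_\ell,b_\ell)$ (in particular the four eigenvalues listed are distinct), where $$a_\ell=-(x_0+3\sqrt3\,y_0 i)^{\ell}-(x_0-3\sqrt3\,y_0 i)^{\ell},$$ $$b_\ell=-\big(y_0-\tfrac{\sqrt3}{9}x_0 i\big)(x_0+3\sqrt3\,y_0 i)^{\ell-1}-\big(y_0+\tfrac{\sqrt3}{9}x_0 i\big)(x_0-3\sqrt3\,y_0 i)^{\ell-1}.$$ 2. The spectrum of $\Gamma(3,p^3)$ determines the spectrum of $\Gamma(3,p^{3\ell})$ for every $\ell\ge1$: if $p'$ is another prime satisfying the same hypotheses and $\mathrm{Spec}\,\Gamma(3,p'^3)=\mathrm{Spec}\,\Gamma(3,p^3)$, then $\mathrm{Spec}\,\Gamma(3,p'^{3\ell})=\mathrm{Spec}\,\Gamma(3,p^{3\ell})$ for every $\ell\ge 1$. Explicitly, whenever $a,b$ are integers with $\mathrm{Spec}\,\Gamma(3,p^3)=S_1(a,b)$, the numbers $x_0=-a/2$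 and $y_0=-b/2$ are integers with $p=x_0^2+27y_0^2$, $(x_0,p)=1$ and $x_0\equiv 1\pmod 3$, so that with these $x_0,y_0$ the formula in 1. gives the spectrum of every $\Gamma(3,p^{3\ell})$, $\ell\ge1$. -/

import Mathlib

noncomputable section

namespace GenPaley

/-- The Cayley graph `X(G, S)`: there is an edge from `v` to `w` iff `w - v ∈ S`. -/
def cayleyGraph (G : Type*) [AddGroup G] (S : Set G) : Digraph G where
  Adj v w := w - v ∈ S

/-- The set `R_k = {x ^ k : x ≠ 0}` of nonzero `k`-th powers of a field. -/
def powerSet (k : ℕ) (F : Type*) [Field F] : Set F :=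
  {y | ∃ x : F, x ≠ 0 ∧ x ^ k = y}

/-- The generalized Paley graph `Γ(k, p ^ m) = X(𝔽_{p ^ m}, R_k)` (for `m ≥ 1`). -/
def gpGraph (k p m : ℕ) [Fact p.Prime] : Digraph (GaloisField p m) :=
  cayleyGraph (GaloisField p m) (powerSet k (GaloisField p m))

open Classical in
/-- The `0`-`1` adjacency matrix of a graph, with complex entries. -/
def adjMatrix {V : Type*} (Γ : Digraph V) : Matrix V V ℂ :=
  Matrix.of fun v w => if Γ.Adj v w then 1 else 0

open Classical in
/-- The spectrum of a finite graph: the multiset of the eigenvalues of its adjacency matrix,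
with multiplicities. -/
def spec {V : Type*} [Finite V] (Γ : Digraph V) : Multiset ℂ :=
  letI := Fintype.ofFinite V
  (adjMatrix Γ).charpoly.roots

/-- `HasSpec Γ [(lam₁, e₁), …, (lamₛ, eₛ)]` says `Spec(Γ) = {[lam₁]^{e₁}, …, [lamₛ]^{eₛ}}`:
the `lamᵢ` are pairwise different, and they are the eigenvalues of `Γ`, with multiplicities `eᵢ`. -/
def HasSpec {V : Type*} [Finite V] (Γ : Digraph V) (L : List (ℂ × ℕ)) : Prop :=
  (L.map Prod.fst).Nodup ∧
    spec Γ = (L.map fun e => Multiset.replicate e.2 e.1).sum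

/-- The list
`[n]^1, [(a p^ℓ - 1)/3]^n, [(-(a + 9b)/2 · p^ℓ - 1)/3]^n, [(-(a - 9b)/2 · p^ℓ - 1)/3]^n`
with `n = (p^(3ℓ) - 1)/3` (an exact division when `p ≡ 1 mod 3`). -/
def cubicSpec (p ℓ : ℕ) (a b : ℂ) : List (ℂ × ℕ) :=
  let n : ℕ := (p ^ (3 * ℓ) - 1) / 3
  [((n : ℂ), 1),
   ((a * (p : ℂ) ^ ℓ - 1) / 3, n),
   ((-(1 / 2) * (a + 9 * b) * (p : ℂ) ^ ℓ - 1) / 3, n),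
   ((-(1 / 2) * (a - 9 * b) * (p : ℂ) ^ ℓ - 1) / 3, n)]

/-- `a_ℓ = -(x + 3√3 y i)^ℓ - (x - 3√3 y i)^ℓ`. -/
def aSeq (x y : ℤ) (ℓ : ℕ) : ℂ :=
  -((x : ℂ) + 3 * (Real.sqrt 3 : ℂ) * y * Complex.I) ^ ℓ
    - ((x : ℂ) - 3 * (Real.sqrt 3 : ℂ) * y * Complex.I) ^ ℓ

/-- `b_ℓ = -(y - (√3/9) x i)(x + 3√3 y i)^(ℓ-1) - (y + (√3/9) x i)(x - 3√3 y i)^(ℓ-1)`,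
for `ℓ ≥ 1`. -/
def bSeq (x y : ℤ) (ℓ : ℕ) : ℂ :=
  -((y : ℂ) - (Real.sqrt 3 : ℂ) / 9 * x * Complex.I)
      * ((x : ℂ) + 3 * (Real.sqrt 3 : ℂ) * y * Complex.I) ^ (ℓ - 1)
    - ((y : ℂ) + (Real.sqrt 3 : ℂ) / 9 * x * Complex.I)
      * ((x : ℂ) - 3 * (Real.sqrt 3 : ℂ) * y * Complex.I) ^ (ℓ - 1)

/-- `(x, y)` is an integral solution of `p = x² + 27 y²` with `(x, p) = 1`, `x ≡ 1 mod 3`. -/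
def IsBaseSolution (p : ℕ) (x y : ℤ) : Prop :=
  (p : ℤ) = x ^ 2 + 27 * y ^ 2 ∧ IsCoprime x (p : ℤ) ∧ x ≡ 1 [ZMOD 3]

/-- `a` is a cubic residue modulo `p`. -/
def IsCubicResidue (a : ℤ) (p : ℕ) : Prop :=
  ∃ x : ℤ, a ≡ x ^ 3 [ZMOD p]

end GenPaley

end

/-! The additive characters of K = 𝔽_{p^(3ℓ)} diagonalise the adjacency matrix, so the eigenvalues
are the sums of these characters over the nonzero cubes. Expanding the indicator of the cubes
through a cubic character θ turns them into (θ(α)² G(θ) + θ(α) G(θ⁻¹) - 1)/3 for α ≠ 0, with G the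
Gauss sum (`spec_cayleyGraph_cubes`).

Take θ = χ ∘ N with χ a cubic character of 𝔽_p. Hasse–Davenport (`sum_norm_trace`) gives G(θ) =
(-1)^(3ℓ-1) G(χ)^(3ℓ), and G(χ)³ = p J(χ, χ), so G(θ) = -p^ℓ (-J(χ, χ))^ℓ. In ℤ[ω] one has J ≡ -1
mod 3, and J ≡ 1 mod 2 because 2 is a cube; with J J̄ = p this forces -J = x + 3√3 y i, where p = x²
+ 27y² and x ≡ 1 mod 3 (`exists_jacobiSum_eq`).

Any other solution differs only in the sign of y, which swaps two eigenvalues of equal multiplicity.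
The eigenvalues are distinct because p does not divide the integer X in (x + 3√3 y i)^ℓ = X + 3√3 Y
i, whence Y ≠ 0. Finally, the number of eigenvalues p³ determines p, and congruences modulo 9
identify a, and b up to sign. -/

namespace HasseDavenport

open Polynomial Finset

/-! ### Monic polynomials and their prime power divisors. -/

section Monics

variable (F : Type*) [Field F] [Fintype F]

open Classical in
/-- The monic polynomials of degree `n` over a finite field. -/
noncomputable def monics (n : ℕ) : Finset F[X] :=
  univ.image fun v : Fin n → F => X ^ n + ∑ i : Fin n, C (v i) * X ^ (i : ℕ)

open Classical in
/-- The pairs `(P, k)` with `P` monic irreducible and `deg (P ^ k) = j`, for `j ≥ 1`. -/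
noncomputable def primePowers (j : ℕ) : Finset (F[X] × ℕ) :=
  (((range (j + 1)).biUnion (monics F)).filter Irreducible ×ˢ Icc 1 j).filter
    fun x => x.2 * x.1.natDegree = j

variable {F}

theorem mem_monics {n : ℕ} {f : F[X]} : f ∈ monics F n ↔ f.Monic ∧ f.natDegree = n := by
  classical
  simp only [monics, mem_image, mem_univ, true_and]
  constructor
  · rintro ⟨v, rfl⟩
    have hdeg : (∑ i : Fin n, C (v i) * X ^ (i : ℕ)).degree < (n : WithBot ℕ) := degree_sum_fin_lt v
    exact ⟨monic_X_pow_add hdeg, natDegree_eq_of_degree_eq_some <| by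
      rw [degree_add_eq_left_of_degree_lt (by simpa using hdeg), degree_X_pow]⟩
  · rintro ⟨hf, rfl⟩
    refine ⟨fun i => f.coeff i, ?_⟩
    conv_rhs => rw [hf.as_sum]
    rw [Finset.sum_range]

theorem mem_primePowers {j : ℕ} (hj : 1 ≤ j) {x : F[X] × ℕ} :
    x ∈ primePowers F j ↔ x.1.Monic ∧ Irreducible x.1 ∧ x.2 * x.1.natDegree = j := by
  classical
  simp only [primePowers, mem_filter, mem_product, mem_biUnion, mem_range, mem_monics, mem_Icc]
  constructor
  · rintro ⟨⟨⟨⟨_, _, h, _⟩, h'⟩, _⟩, h''⟩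
    exact ⟨h, h', h''⟩
  · rintro ⟨h, h', h''⟩
    have := h'.natDegree_pos
    have : 0 < x.2 := Nat.pos_of_ne_zero fun h0 => by simp [h0] at h''; omega
    refine ⟨⟨⟨⟨x.1.natDegree, ?_, h, rfl⟩, h'⟩, by omega, ?_⟩, h''⟩ <;> nlinarith

/-- The degree of `f`, counted through the prime powers dividing it. -/
theorem sum_primePowers_dvd {n : ℕ} {f : F[X]} (hf : f ∈ monics F n) [DecidableRel (α := F[X]) (· ∣ ·)] :
    ∑ j ∈ Icc 1 n, ∑ x ∈ primePowers F j, (if x.1 ^ x.2 ∣ f then x.1.natDegree else 0) = n := by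
  classical
  obtain ⟨hm, rfl⟩ := mem_monics.1 hf
  set m := UniqueFactorizationMonoid.normalizedFactors f with hmdef
  have hprod : m.prod = f := by
    rw [hmdef, UniqueFactorizationMonoid.prod_normalizedFactors_eq hm.ne_zero, hm.normalize_eq_self]
  have hmem : ∀ P ∈ m, Irreducible P ∧ P.Monic := fun P hP =>
    ⟨UniqueFactorizationMonoid.irreducible_of_normalized_factor P hP, by
      have h := UniqueFactorizationMonoid.irreducible_of_normalized_factor P hP
      rw [← UniqueFactorizationMonoid.normalize_normalized_factor P hP]
      exact monic_normalize h.ne_zero⟩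
  have hdvd : ∀ P : F[X], P.Monic → Irreducible P → ∀ k : ℕ, P ^ k ∣ f ↔ k ≤ m.count P := by
    intro P hP hI k
    rw [pow_dvd_iff_le_emultiplicity,
      UniqueFactorizationMonoid.emultiplicity_eq_count_normalizedFactors hI hm.ne_zero,
      hP.normalize_eq_self, Nat.cast_le]
  -- Each irreducible factor P of multiplicity m contributes deg P once for each of P, P², …, P^m.
  have hdeg : f.natDegree = ∑ P ∈ m.toFinset, ∑ k ∈ Icc 1 (m.count P), P.natDegree := by
    conv_lhs => rw [← hprod]
    rw [natDegree_multiset_prod_of_monic _ fun P hP => (hmem P hP).2,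
      Finset.sum_multiset_map_count]
    simp
  conv_rhs => rw [hdeg]
  simp_rw [← sum_filter]
  rw [sum_sigma', sum_sigma']
  refine sum_bij' (fun x _ => ⟨x.2.1, x.2.2⟩) (fun y _ => ⟨y.2 * y.1.natDegree, (y.1, y.2)⟩)
    ?_ ?_ ?_ ?_ ?_
  · rintro ⟨j, P, k⟩ h
    simp only [mem_sigma, mem_filter, mem_Icc] at h
    obtain ⟨⟨hj, -⟩, h, hd⟩ := h
    obtain ⟨hP, hI, rfl⟩ := (mem_primePowers hj).1 h
    have hk : 1 ≤ k := Nat.pos_of_ne_zero fun h0 => by simp [h0] at hj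
    have := (hdvd P hP hI k).1 hd
    simp only [mem_sigma, Multiset.mem_toFinset, mem_Icc]
    exact ⟨Multiset.count_pos.1 (by omega), hk, this⟩
  · rintro ⟨P, k⟩ h
    simp only [mem_sigma, Multiset.mem_toFinset, mem_Icc] at h
    obtain ⟨h, hk, hk'⟩ := h
    have hd := (hdvd P (hmem P h).2 (hmem P h).1 k).2 hk'
    have h1 : 1 ≤ k * P.natDegree := Nat.mul_pos hk (hmem P h).1.natDegree_pos
    simp only [mem_sigma, mem_filter, mem_Icc, mem_primePowers h1]
    refine ⟨⟨h1, ?_⟩, ⟨(hmem P h).2, (hmem P h).1, trivial⟩, hd⟩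
    simpa using natDegree_le_of_dvd hd hm.ne_zero
  · rintro ⟨j, P, k⟩ h
    simp only [mem_sigma, mem_filter, mem_Icc] at h
    obtain ⟨⟨hj, -⟩, h, hd⟩ := h
    obtain ⟨hP, hI, rfl⟩ := (mem_primePowers hj).1 h
    rfl
  · rintro ⟨P, k⟩ h
    rfl
  · rintro ⟨j, P, k⟩ h
    rfl

end Monics

/-! ### The L-series of the weight and its logarithmic derivative. -/

section Weight

variable {F R : Type*} [Field F] [Fintype F] [CommRing R]
  (χ : MulChar F R) (ψ : AddChar F R)

/-- The multiplicative weight `χ(c_n) ψ(c_1)` of a monic polynomial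
`X ^ n - c_1 X ^ (n - 1) + ⋯ + (-1) ^ n c_n`. -/
noncomputable def weight (f : F[X]) : R :=
  χ ((-1) ^ f.natDegree * f.coeff 0) * ψ (-f.nextCoeff)

/-- The sum of the weights of the monic polynomials of degree `n`. -/
noncomputable def weightSum (n : ℕ) : R :=
  ∑ f ∈ monics F n, weight χ ψ f

/-- The sum of `deg P * weight P ^ k` over the prime powers `P ^ k` of degree `n`. -/
noncomputable def primePowerSum (n : ℕ) : R :=
  ∑ x ∈ primePowers F n, (x.1.natDegree : R) * weight χ ψ x.1 ^ x.2

variable {χ ψ}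

omit [Fintype F] in
theorem weight_one : weight χ ψ (1 : F[X]) = 1 := by
  simp [weight, nextCoeff]

omit [Fintype F] in
theorem weight_mul {f g : F[X]} (hf : f.Monic) (hg : g.Monic) :
    weight χ ψ (f * g) = weight χ ψ f * weight χ ψ g := by
  rw [weight, weight, weight, hf.natDegree_mul hg, hf.nextCoeff_mul hg, neg_add,
    AddChar.map_add_eq_mul, mul_coeff_zero, pow_add, mul_mul_mul_comm, map_mul]
  ring

omit [Fintype F] in
theorem weight_pow {f : F[X]} (hf : f.Monic) (k : ℕ) :
    weight χ ψ (f ^ k) = weight χ ψ f ^ k := by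
  induction k with
  | zero => simp [weight_one]
  | succ k ih => rw [pow_succ, weight_mul (hf.pow k) hf, ih, pow_succ]

theorem weightSum_zero : weightSum χ ψ 0 = 1 := by
  have : monics F 0 = {1} := by
    ext f
    rw [mem_monics, mem_singleton]
    exact ⟨fun h => eq_one_of_monic_natDegree_zero h.1 h.2, fun h => by simp [h]⟩
  rw [weightSum, this, sum_singleton, weight_one]

theorem weightSum_one : weightSum χ ψ 1 = gaussSum χ ψ := by
  rw [weightSum, gaussSum]
  refine (sum_bij (fun a _ => X - C a) ?_ ?_ ?_ ?_).symm
  · intro a _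
    exact mem_monics.2 ⟨monic_X_sub_C a, natDegree_X_sub_C a⟩
  · intro a _ b _ h
    simpa using h
  · intro f hf
    obtain ⟨hm, hd⟩ := mem_monics.1 hf
    refine ⟨-f.coeff 0, mem_univ _, ?_⟩
    conv_rhs => rw [hm.as_sum, hd]
    simp
  · intro a _
    simp [weight, nextCoeff]

/-- Adding c X^(n-1) permutes the monic polynomials of degree n. For n ≥ 2 the constant coefficient
is untouched, so every weight is scaled by the same factor, which differs from 1 for suitable c. -/
theorem weightSum_eq_zero [IsDomain R] (hψ : ψ ≠ 1) {n : ℕ} (hn : 2 ≤ n) :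
    weightSum χ ψ n = 0 := by
  obtain ⟨c, hc⟩ := AddChar.ne_one_iff.1 hψ
  have hlt : ∀ a : F, (C a * X ^ (n - 1)).degree < (n : WithBot ℕ) := fun a =>
    (degree_C_mul_X_pow_le _ _).trans_lt (by exact_mod_cast (by omega : n - 1 < n))
  have hmem : ∀ (a : F) (f : F[X]), f ∈ monics F n → f + C a * X ^ (n - 1) ∈ monics F n := by
    intro a f hf
    obtain ⟨hm, hd⟩ := mem_monics.1 hf
    have hd' : f.degree = n := by rw [degree_eq_natDegree hm.ne_zero, hd]
    have hlt' : (C a * X ^ (n - 1)).degree < f.degree := hd' ▸ hlt a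
    exact mem_monics.2 ⟨hm.add_of_left hlt', natDegree_eq_of_degree_eq_some <| by
      rw [degree_add_eq_left_of_degree_lt hlt', hd']⟩
  have key : weightSum χ ψ n = ψ c * weightSum χ ψ n := by
    conv_rhs => rw [weightSum, mul_sum]
    rw [weightSum]
    refine sum_bij' (fun f _ => f + C c * X ^ (n - 1)) (fun f _ => f + C (-c) * X ^ (n - 1))
      (hmem c) (hmem (-c)) ?_ ?_ ?_
    · intro f _
      simp
    · intro f _
      simp
    · intro f hf
      have h1 := mem_monics.1 hf
      have h2 := mem_monics.1 (hmem c f hf)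
      rw [weight, weight, h1.2, h2.2, nextCoeff_of_natDegree_pos (by omega),
        nextCoeff_of_natDegree_pos (by omega), h1.2, h2.2, coeff_add, coeff_add,
        coeff_C_mul_X_pow, coeff_C_mul_X_pow, if_neg (by omega), if_pos rfl, add_zero, neg_add,
        AddChar.map_add_eq_mul, mul_comm (ψ c), mul_assoc, mul_assoc,
        ← AddChar.map_add_eq_mul, neg_add_cancel, AddChar.map_zero_eq_one, mul_one]
  have : (ψ c - 1) * weightSum χ ψ n = 0 := by rw [sub_mul, one_mul, ← key, sub_self]
  exact (mul_eq_zero.1 this).resolve_left (sub_ne_zero.2 hc)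

theorem sum_weight_dvd {n : ℕ} {g : F[X]} (hg : g.Monic) (hn : g.natDegree ≤ n)
    [DecidablePred (g ∣ ·)] :
    ∑ f ∈ monics F n with g ∣ f, weight χ ψ f = weight χ ψ g * weightSum χ ψ (n - g.natDegree) := by
  rw [weightSum, mul_sum]
  refine (sum_bij (fun f _ => g * f) ?_ ?_ ?_ ?_).symm
  · intro f hf
    obtain ⟨hm, hd⟩ := mem_monics.1 hf
    rw [mem_filter, mem_monics, hg.natDegree_mul hm, hd]
    exact ⟨⟨hg.mul hm, by omega⟩, dvd_mul_right _ _⟩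
  · intro f _ f' _ h
    exact mul_left_cancel₀ hg.ne_zero h
  · intro f hf
    obtain ⟨hf, h, rfl⟩ := mem_filter.1 hf
    obtain ⟨hm, hd⟩ := mem_monics.1 hf
    have hm' : h.Monic := hg.of_mul_monic_left hm
    refine ⟨h, mem_monics.2 ⟨hm', ?_⟩, rfl⟩
    rw [hg.natDegree_mul hm'] at hd
    omega
  · intro f hf
    exact (weight_mul hg (mem_monics.1 hf).1).symm

/-- The logarithmic derivative of the Euler product of the `L`-series `∑ weightSum n * T ^ n`. -/
theorem natCast_mul_weightSum (n : ℕ) :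
    (n : R) * weightSum χ ψ n =
      ∑ j ∈ Icc 1 n, primePowerSum χ ψ j * weightSum χ ψ (n - j) := by
  classical
  -- The factor n is deg f, split over the prime powers dividing f; exchanging the sums then leaves
  -- the multiples of a fixed P^k.
  have h1 : (n : R) * weightSum χ ψ n = ∑ f ∈ monics F n, ∑ j ∈ Icc 1 n,
      ∑ x ∈ primePowers F j, if x.1 ^ x.2 ∣ f then (x.1.natDegree : R) * weight χ ψ f else 0 := by
    rw [weightSum, mul_sum]
    refine sum_congr rfl fun f hf => ?_
    conv_lhs => rw [← sum_primePowers_dvd hf]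
    push_cast
    simp_rw [sum_mul, ite_mul, zero_mul]
  rw [h1, sum_comm]
  refine sum_congr rfl fun j hj => ?_
  obtain ⟨hj, hjn⟩ := mem_Icc.1 hj
  rw [sum_comm, primePowerSum, sum_mul]
  refine sum_congr rfl fun x hx => ?_
  obtain ⟨hm, -, hd⟩ := (mem_primePowers hj).1 hx
  have hd' : (x.1 ^ x.2).natDegree = j := by rw [natDegree_pow, hd]
  rw [← sum_filter, ← mul_sum, sum_weight_dvd (hm.pow _) (hd'.trans_le hjn), hd', weight_pow hm,
    mul_assoc]

/-- The L-series is 1 + G T with G the Gauss sum, so at most the last two terms of the recursion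
survive. -/
theorem primePowerSum_succ [IsDomain R] (hψ : ψ ≠ 1) (n : ℕ) :
    primePowerSum χ ψ (n + 1) = (-1) ^ n * gaussSum χ ψ ^ (n + 1) := by
  induction n with
  | zero => simpa [weightSum_zero, weightSum_one] using (natCast_mul_weightSum (χ := χ) (ψ := ψ) 1).symm
  | succ n ih =>
    have h := natCast_mul_weightSum (χ := χ) (ψ := ψ) (n + 1 + 1)
    rw [weightSum_eq_zero hψ (by omega), mul_zero, sum_Icc_succ_top (by omega),
      sum_Icc_succ_top (by omega), sum_eq_zero, zero_add, ih] at h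
    · simp only [Nat.sub_self, weightSum_zero, Nat.add_sub_cancel_left, weightSum_one] at h
      rw [mul_one] at h
      linear_combination -h
    · intro j hj
      rw [weightSum_eq_zero hψ (by have := (mem_Icc.1 hj).2; omega), mul_zero]

end Weight

/-! ### Hasse–Davenport, by sorting the elements of the extension by minimal polynomial. -/

section Extension

variable {F K R : Type*} [Field F] [Fintype F] [Field K] [Fintype K] [Algebra F K] [CommRing R]
  {χ : MulChar F R} {ψ : AddChar F R}

/-- P divides X^|K| - X, which splits over K with simple roots. -/
theorem card_minpoly_eq {P : F[X]} (hm : P.Monic) (hP : Irreducible P)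
    (hd : P.natDegree ∣ Module.finrank F K) [DecidableEq F[X]] :
    #{α : K | minpoly F α = P} = P.natDegree := by
  classical
  have hdvd : P ∣ X ^ Fintype.card K - X := by
    have := hP.natDegree_dvd_iff_dvd_X_pow_card_pow_sub_X.1 hd
    rwa [← Module.natCard_eq_pow_finrank (K := F) (V := K), Nat.card_eq_fintype_card] at this
  have hdvd' : P.map (algebraMap F K) ∣ X ^ Fintype.card K - X := by
    simpa using Polynomial.map_dvd (algebraMap F K) hdvd
  have h0 : (X ^ Fintype.card K - X : K[X]) ≠ 0 :=
    FiniteField.X_pow_card_sub_X_ne_zero K Fintype.one_lt_card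
  have hsplit : (P.map (algebraMap F K)).Splits :=
    Splits.of_dvd (by simpa using (FiniteField.isSplittingField_sub K F).splits) h0 hdvd'
  have hnodup : (P.map (algebraMap F K)).roots.Nodup := by
    refine Multiset.nodup_of_le (roots.le_of_dvd h0 hdvd') ?_
    rw [FiniteField.roots_X_pow_card_sub_X]
    exact univ.nodup
  have hset : ({α : K | minpoly F α = P} : Finset K) = (P.map (algebraMap F K)).roots.toFinset := by
    ext α
    rw [mem_filter, Multiset.mem_toFinset, mem_roots (hm.map _).ne_zero, IsRoot.def, eval_map_algebraMap]
    constructor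
    · rintro ⟨-, rfl⟩
      exact minpoly.aeval F α
    · intro h
      exact ⟨mem_univ _, (minpoly.eq_of_irreducible_of_monic hP h hm).symm⟩
  rw [hset, Multiset.toFinset_card_of_nodup hnodup, ← hsplit.natDegree_eq_card_roots, natDegree_map]

-- Up to sign, the coefficients in the weight are the norm and trace of α from F(α); the exponent is
-- [K : F(α)], which passes to the norm and trace from K.
omit [Fintype F] in
theorem weight_minpoly_pow (α : K) :
    weight χ ψ (minpoly F α) ^ (Module.finrank F K / (minpoly F α).natDegree) =
      χ (Algebra.norm F α) * ψ (Algebra.trace F K α) := by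
  have hint : IsIntegral F α := IsIntegral.of_finite F α
  have hdeg := IntermediateField.adjoin.finrank hint
  have hfin : Module.finrank F K / (minpoly F α).natDegree =
      Module.finrank (IntermediateField.adjoin F {α}) K := by
    rw [← hdeg, ← Module.finrank_mul_finrank F (IntermediateField.adjoin F {α}) K]
    exact Nat.mul_div_cancel_left _ Module.finrank_pos
  have hN : Algebra.norm F (IntermediateField.AdjoinSimple.gen F α) =
      (-1) ^ (minpoly F α).natDegree * (minpoly F α).coeff 0 := by
    have := Algebra.PowerBasis.norm_gen_eq_coeff_zero_minpoly
      (IntermediateField.adjoin.powerBasis hint)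
    rwa [IntermediateField.adjoin.powerBasis_gen, IntermediateField.minpoly_gen,
      IntermediateField.adjoin.powerBasis_dim] at this
  rw [hfin, Algebra.norm_eq_norm_adjoin, trace_eq_trace_adjoin, trace_adjoinSimpleGen hint,
    AddChar.map_nsmul_eq_pow, hN, map_pow, weight, mul_pow]

theorem sum_norm_trace_eq_primePowerSum :
    ∑ α : K, χ (Algebra.norm F α) * ψ (Algebra.trace F K α) =
      primePowerSum χ ψ (Module.finrank F K) := by
  classical
  have hn : 1 ≤ Module.finrank F K := Module.finrank_pos
  have hdvd : ∀ α : K, (minpoly F α).natDegree ∣ Module.finrank F K := fun α =>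
    minpoly.degree_dvd (IsIntegral.of_finite F α)
  have hmaps : ∀ α ∈ (univ : Finset K),
      (minpoly F α, Module.finrank F K / (minpoly F α).natDegree) ∈
        primePowers F (Module.finrank F K) := fun α _ =>
    (mem_primePowers hn).2 ⟨minpoly.monic (IsIntegral.of_finite F α),
      minpoly.irreducible (IsIntegral.of_finite F α), Nat.div_mul_cancel (hdvd α)⟩
  rw [← sum_fiberwise_of_maps_to hmaps, primePowerSum]
  refine sum_congr rfl fun x hx => ?_
  obtain ⟨hm, hI, hd⟩ := (mem_primePowers hn).1 hx
  have hk : Module.finrank F K / x.1.natDegree = x.2 := by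
    rw [← hd, Nat.mul_div_cancel _ hI.natDegree_pos]
  have hset : ({α : K | (minpoly F α, Module.finrank F K / (minpoly F α).natDegree) = x} : Finset K)
      = ({α : K | minpoly F α = x.1} : Finset K) := by
    ext α
    simp only [mem_filter, mem_univ, true_and, Prod.ext_iff]
    exact ⟨fun h => h.1, fun h => ⟨h, by rw [h, hk]⟩⟩
  rw [hset, ← card_minpoly_eq (K := K) hm hI ⟨x.2, by rw [mul_comm, hd]⟩, ← nsmul_eq_mul, ← sum_const]
  refine sum_congr rfl fun α hα => ?_
  rw [← (mem_filter.1 hα).2] at hk ⊢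
  rw [← weight_minpoly_pow, hk]

/-- The **Hasse–Davenport relation**. -/
theorem sum_norm_trace [IsDomain R] (hψ : ψ ≠ 1) :
    ∑ α : K, χ (Algebra.norm F α) * ψ (Algebra.trace F K α) =
      (-1) ^ (Module.finrank F K - 1) * gaussSum χ ψ ^ Module.finrank F K := by
  have hn : 1 ≤ Module.finrank F K := Module.finrank_pos
  rw [sum_norm_trace_eq_primePowerSum]
  conv_lhs => rw [← Nat.sub_add_cancel hn]
  rw [primePowerSum_succ hψ, Nat.sub_add_cancel hn]

end Extension

end HasseDavenport

/-! ### Arithmetic in ℤ[ω]. -/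

namespace GenPaley

open Finset

/-- The primitive cube root of unity `(-1 + √3 i) / 2`. -/
noncomputable def omega : ℂ := -(1 / 2) + (Real.sqrt 3 : ℂ) / 2 * Complex.I

theorem sqrt_three_sq : (Real.sqrt 3 : ℂ) ^ 2 = 3 := by
  rw [← Complex.ofReal_pow, Real.sq_sqrt (by norm_num)]
  norm_num

theorem omega_sq : omega ^ 2 = -1 - omega := by
  rw [omega]
  linear_combination (Complex.I ^ 2 / 4) * sqrt_three_sq + 3 / 4 * Complex.I_sq

theorem omega_cube : omega ^ 3 = 1 := by
  linear_combination (omega - 1) * omega_sq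

theorem omega_im : omega.im = Real.sqrt 3 / 2 := by
  have : omega = ((-(1 / 2) : ℝ) : ℂ) + ((Real.sqrt 3 / 2 : ℝ) : ℂ) * Complex.I := by
    rw [omega]; push_cast; ring
  rw [this]
  simp only [Complex.add_im, Complex.ofReal_im, Complex.im_ofReal_mul, Complex.I_im]
  ring

theorem omega_im_ne_zero : omega.im ≠ 0 := by
  rw [omega_im]
  positivity

theorem omega_isPrimitiveRoot : IsPrimitiveRoot omega 3 :=
  IsPrimitiveRoot.iff_orderOf.2 <| orderOf_eq_prime omega_cube fun h => omega_im_ne_zero (by simp [h])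

theorem eq_omega_or_sq {z : ℂ} (h3 : z ^ 3 = 1) (h1 : z ≠ 1) : z = omega ∨ z = omega ^ 2 := by
  have h : (z - 1) * ((z - omega) * (z - omega ^ 2)) = 0 := by
    linear_combination h3 + (z - 1) * omega_cube + (z - z ^ 2) * omega_sq
  rcases mul_eq_zero.1 ((mul_eq_zero.1 h).resolve_left (sub_ne_zero.2 h1)) with h | h
  · exact Or.inl (sub_eq_zero.1 h)
  · exact Or.inr (sub_eq_zero.1 h)

theorem exists_of_mem_adjoin_omega {z : ℂ} (hz : z ∈ Algebra.adjoin ℤ {omega}) :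
    ∃ a b : ℤ, z = a + b * omega := by
  induction hz using Algebra.adjoin_induction with
  | mem x hx => exact ⟨0, 1, by rw [Set.mem_singleton_iff.1 hx]; simp⟩
  | algebraMap r => exact ⟨r, 0, by simp⟩
  | add x y _ _ hx hy =>
    obtain ⟨a, b, rfl⟩ := hx
    obtain ⟨c, d, rfl⟩ := hy
    exact ⟨a + c, b + d, by push_cast; ring⟩
  | mul x y _ _ hx hy =>
    obtain ⟨a, b, rfl⟩ := hx
    obtain ⟨c, d, rfl⟩ := hy
    exact ⟨a * c - b * d, a * d + b * c - b * d, by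
      push_cast
      linear_combination (b * d : ℂ) * omega_sq⟩

theorem add_mul_omega_inj {a b c d : ℤ} (h : (a + b * omega : ℂ) = c + d * omega) :
    a = c ∧ b = d := by
  have him := congrArg Complex.im h
  simp only [Complex.add_im, Complex.intCast_im, Complex.mul_im, Complex.intCast_re, zero_add,
    zero_mul, add_zero] at him
  have hb : b = d := by exact_mod_cast mul_right_cancel₀ omega_im_ne_zero him
  subst hb
  exact ⟨by exact_mod_cast add_right_cancel h, rfl⟩

/-! ### Cubic Jacobi and Gauss sums. -/

section JacobiSum

variable {F : Type*} [Field F] [Fintype F] {χ : MulChar F ℂ}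

/-- If `2` is a cube, then `J(χ, χ) ≡ 1 mod 2` for a cubic character `χ`. -/
theorem exists_jacobiSum_eq_one_add (hχ : χ ^ 3 = 1) (h2 : (2 : F) ≠ 0) (hχ2 : χ 2 = 1) :
    ∃ z ∈ Algebra.adjoin ℤ {omega}, jacobiSum χ χ = 1 + 2 * z := by
  classical
  -- S is 2ℤ[ω]. Modulo S the equal terms at x and 1 - x cancel, leaving only the fixed point x =
  -- 1/2.
  let S : AddSubgroup ℂ := (Subalgebra.toSubmodule (Algebra.adjoin ℤ {omega})).toAddSubgroup.map
    (AddMonoidHom.mulLeft 2)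
  have hsum : ∑ x ∈ univ.erase (2⁻¹ : F), (QuotientAddGroup.mk (χ x * χ (1 - x)) : ℂ ⧸ S) = 0 := by
    refine sum_involution (fun x _ => 1 - x) ?_ ?_ ?_ ?_
    · intro x _
      rw [sub_sub_cancel, ← QuotientAddGroup.mk_add, QuotientAddGroup.eq_zero_iff]
      refine ⟨χ x * χ (1 - x), ?_, ?_⟩
      · exact Subalgebra.mul_mem _
          (MulChar.apply_mem_algebraAdjoin_of_pow_eq_one hχ omega_isPrimitiveRoot _)
          (MulChar.apply_mem_algebraAdjoin_of_pow_eq_one hχ omega_isPrimitiveRoot _)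
      · simp only [AddMonoidHom.coe_mulLeft]
        ring
    · intro x hx _ h
      refine (mem_erase.1 hx).1 (eq_inv_of_mul_eq_one_left ?_)
      linear_combination -h
    · intro x hx
      refine mem_erase.2 ⟨fun h => (mem_erase.1 hx).1 ?_, mem_univ _⟩
      have : x = 1 - 2⁻¹ := by rw [← h]; ring
      rw [this]
      field_simp
      norm_num
    · intro x _
      ring
  have hmem : ∑ x ∈ univ.erase (2⁻¹ : F), χ x * χ (1 - x) ∈ S := by
    rw [← QuotientAddGroup.eq_zero_iff, ← hsum]
    exact map_sum (QuotientAddGroup.mk' S) _ _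
  obtain ⟨z, hz, hzeq⟩ := hmem
  refine ⟨z, hz, ?_⟩
  have hhalf : χ 2⁻¹ * χ (1 - 2⁻¹) = 1 := by
    have h1 : (1 - 2⁻¹ : F) = 2⁻¹ := by field_simp; norm_num
    have h3 : χ 2⁻¹ = 1 := by
      have : χ (2 * 2⁻¹) = 1 := by rw [mul_inv_cancel₀ h2, map_one]
      rwa [map_mul, hχ2, one_mul] at this
    rw [h1, h3, one_mul]
  rw [jacobiSum, ← add_sum_erase _ _ (mem_univ (2⁻¹ : F)), hhalf, ← hzeq]
  rfl

theorem jacobiSum_inv_inv : jacobiSum χ⁻¹ χ⁻¹ = (starRingEnd ℂ) (jacobiSum χ χ) := by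
  simp only [jacobiSum, map_sum, map_mul]
  refine sum_congr rfl fun x _ => ?_
  rw [← MulChar.star_apply', ← MulChar.star_apply']
  rfl

/-- The Jacobi sum of a cubic character `χ` with `χ 2 = 1`. -/
theorem exists_jacobiSum_eq (hχ : orderOf χ = 3) (h2 : (2 : F) ≠ 0) (hχ2 : χ 2 = 1) :
    ∃ x y : ℤ, (Fintype.card F : ℤ) = x ^ 2 + 27 * y ^ 2 ∧ x ≡ 1 [ZMOD 3] ∧
      -jacobiSum χ χ = x + 3 * (Real.sqrt 3 : ℂ) * y * Complex.I ∧
      -jacobiSum χ⁻¹ χ⁻¹ = x - 3 * (Real.sqrt 3 : ℂ) * y * Complex.I := by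
  have hχ3 : χ ^ 3 = 1 := hχ ▸ pow_orderOf_eq_one χ
  have hχ1 : χ ≠ 1 := fun h => by simp [h] at hχ
  have hχχ : χ * χ ≠ 1 := fun h => by
    have := orderOf_dvd_of_pow_eq_one (show χ ^ 2 = 1 by rw [sq, h])
    rw [hχ] at this
    norm_num at this
  -- This gives J = -1 + z (ω - 1)², and (ω - 1)² = -3ω.
  obtain ⟨z, hz, hJ⟩ := exists_jacobiSum_eq_neg_one_add (by norm_num) hχ3 hχ3
    (hχ ▸ MulChar.orderOf_dvd_card_sub_one F χ) omega_isPrimitiveRoot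
  obtain ⟨w, hw, hJ'⟩ := exists_jacobiSum_eq_one_add hχ3 h2 hχ2
  obtain ⟨a, b, rfl⟩ := exists_of_mem_adjoin_omega hz
  obtain ⟨c, d, rfl⟩ := exists_of_mem_adjoin_omega hw
  have hJ1 : jacobiSum χ χ = ((3 * b - 1 : ℤ) : ℂ) + ((3 * (b - a) : ℤ) : ℂ) * omega := by
    rw [hJ]
    push_cast
    linear_combination (a - 3 * b + b * omega : ℂ) * omega_sq
  have hJ2 : jacobiSum χ χ = ((1 + 2 * c : ℤ) : ℂ) + ((2 * d : ℤ) : ℂ) * omega := by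
    rw [hJ']
    push_cast
    ring
  -- Comparing coefficients of ω gives 3(b - a) = 2d, so b - a is even; this is what makes the
  -- imaginary part a multiple of 3√3.
  obtain ⟨-, hbd⟩ := add_mul_omega_inj (hJ1.symm.trans hJ2)
  obtain ⟨e, he⟩ : ∃ e : ℤ, b - a = 2 * e := ⟨(b - a) / 2, by omega⟩
  obtain rfl : a = b - 2 * e := by omega
  have hx : -jacobiSum χ χ = ((1 - 3 * b + 3 * e : ℤ) : ℂ) +
      3 * (Real.sqrt 3 : ℂ) * ((-e : ℤ) : ℂ) * Complex.I := by
    rw [hJ1, omega]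
    push_cast
    ring
  have hx' : -jacobiSum χ⁻¹ χ⁻¹ = ((1 - 3 * b + 3 * e : ℤ) : ℂ) -
      3 * (Real.sqrt 3 : ℂ) * ((-e : ℤ) : ℂ) * Complex.I := by
    rw [jacobiSum_inv_inv, ← map_neg, hx]
    simp only [map_add, map_mul, Complex.conj_I, Complex.conj_ofReal, map_intCast, map_ofNat]
    ring
  refine ⟨1 - 3 * b + 3 * e, -e, ?_, ?_, hx, hx'⟩
  · have hchar : ringChar ℂ ≠ ringChar F := by
      rw [ringChar.eq_zero]
      exact (CharP.char_ne_zero_of_finite F (ringChar F)).symm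
    have hnorm := jacobiSum_mul_jacobiSum_inv hchar hχ1 hχ1 hχχ
    rw [← neg_mul_neg, hx, hx'] at hnorm
    have : ((Fintype.card F : ℤ) : ℂ) = (((1 - 3 * b + 3 * e) ^ 2 + 27 * (-e) ^ 2 : ℤ) : ℂ) := by
      rw [Int.cast_natCast, ← hnorm]
      push_cast
      linear_combination (-9 * (e : ℂ) ^ 2 * Complex.I ^ 2) * sqrt_three_sq
        - 27 * (e : ℂ) ^ 2 * Complex.I_sq
    exact_mod_cast this
  · rw [Int.modEq_iff_dvd]
    exact ⟨b - e, by ring⟩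

/-- The cube of the Gauss sum of a cubic character. -/
theorem gaussSum_cube (hχ : orderOf χ = 3) {ψ : AddChar F ℂ} (hψ : ψ.IsPrimitive) :
    gaussSum χ ψ ^ 3 = Fintype.card F * jacobiSum χ χ := by
  have h := gaussSum_pow_eq_prod_jacobiSum (hχ ▸ by norm_num : 2 ≤ orderOf χ) hψ
  have h1 : χ (-1) = 1 := by
    have hχ3 : χ ^ 3 = 1 := hχ ▸ pow_orderOf_eq_one χ
    calc χ (-1) = χ (-1) ^ 3 := by rw [← map_pow]; norm_num
      _ = (χ ^ 3) (-1) := (MulChar.pow_apply' χ (by norm_num) _).symm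
      _ = 1 := by rw [hχ3]; exact MulChar.one_apply (by simp)
  rwa [hχ, h1, one_mul, show Ico 1 (3 - 1) = {1} from rfl, prod_singleton, pow_one] at h

theorem sum_norm_trace_of_finrank_eq_three_mul {K : Type*} [Field K] [Fintype K] [Algebra F K]
    (hχ : orderOf χ = 3) {ψ : AddChar F ℂ} (hψ : ψ ≠ 1) {ℓ : ℕ} (hℓ : 1 ≤ ℓ)
    (hK : Module.finrank F K = 3 * ℓ) :
    ∑ α : K, χ (Algebra.norm F α) * ψ (Algebra.trace F K α) =
      -(Fintype.card F : ℂ) ^ ℓ * (-jacobiSum χ χ) ^ ℓ := by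
  rw [HasseDavenport.sum_norm_trace hψ, hK, pow_mul, gaussSum_cube hχ (AddChar.IsPrimitive.of_ne_one hψ),
    mul_pow, neg_pow (jacobiSum χ χ)]
  -- The Hasse–Davenport sign cancels against the one in (-J)^ℓ, up to a single minus.
  have : (-1 : ℂ) ^ (3 * ℓ - 1) = -(-1) ^ ℓ := by
    have h1 : (-1 : ℂ) ^ (3 * ℓ - 1 + 1) = (-1) ^ ℓ := by
      rw [Nat.sub_add_cancel (by omega), pow_mul]
      norm_num
    rw [pow_succ] at h1
    linear_combination -h1
  rw [this]
  ring

end JacobiSum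

theorem spec_eq_roots {V : Type*} [Fintype V] [DecidableEq V] (Γ : Digraph V) :
    spec Γ = (adjMatrix Γ).charpoly.roots := by
  unfold spec
  congr!

/-! ### Spectra of Cayley graphs on finite fields. -/

section Cayley

variable {K : Type*} [Field K] [Fintype K]

/-- The eigenvalues of a Cayley graph on the additive group of a finite field are the character
sums over the connection set. -/
theorem spec_cayleyGraph {Ψ : AddChar K ℂ} (hΨ : Ψ.IsPrimitive) (S : Set K)
    [DecidablePred (· ∈ S)] :
    spec (cayleyGraph K S) = (univ : Finset K).val.map fun α => ∑ s with s ∈ S, Ψ (s * α) := by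
  classical
  set lam : K → ℂ := fun α => ∑ s with s ∈ S, Ψ (s * α) with hlam
  set A := adjMatrix (cayleyGraph K S)
  -- The columns of V are the additive characters, which are eigenvectors of A; orthogonality makes
  -- W the inverse of V.
  let V : Matrix K K ℂ := Matrix.of fun v α => Ψ (v * α)
  let W : Matrix K K ℂ := Matrix.of fun α v => (Fintype.card K : ℂ)⁻¹ * Ψ (-(v * α))
  have hq : (Fintype.card K : ℂ) ≠ 0 := by simp
  have hVW : V * W = 1 := by
    ext v w
    have h : ∀ α : K, V v α * W α w = (Fintype.card K : ℂ)⁻¹ * Ψ (α * (v - w)) := by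
      intro α
      simp only [V, W, Matrix.of_apply]
      rw [mul_left_comm, ← AddChar.map_add_eq_mul]
      congr 2
      ring
    rw [Matrix.mul_apply, sum_congr rfl fun α _ => h α, ← mul_sum, AddChar.sum_mulShift _ hΨ,
      Matrix.one_apply]
    by_cases hvw : v = w
    · simp [hvw, hq]
    · simp [hvw, sub_ne_zero.2 hvw]
  have hAV : A * V = V * Matrix.diagonal lam := by
    ext v α
    rw [Matrix.mul_apply, Matrix.mul_diagonal]
    simp only [A, V, adjMatrix, cayleyGraph, Matrix.of_apply, hlam]
    rw [← Equiv.sum_comp (Equiv.addLeft v), mul_sum, sum_filter]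
    refine sum_congr rfl fun s _ => ?_
    simp [add_mul, AddChar.map_add_eq_mul]
  have hA : A = V * Matrix.diagonal lam * W := by
    rw [← hAV, Matrix.mul_assoc, hVW, Matrix.mul_one]
  rw [spec_eq_roots]
  change A.charpoly.roots = _
  rw [hA, Matrix.charpoly_mul_comm, ← Matrix.mul_assoc, mul_eq_one_comm.1 hVW,
    Matrix.one_mul, Matrix.charpoly_diagonal]
  have := Polynomial.roots_multiset_prod_X_sub_C ((univ : Finset K).val.map lam)
  rwa [Multiset.map_map] at this

end Cayley

theorem map_pow_range_three_mul (h : ℂ → ℂ) {z : ℂ} (hz : z ^ 3 = 1) (n : ℕ) :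
    (Multiset.range (3 * n)).map (fun k => h (z ^ k)) =
      Multiset.replicate n (h 1) + Multiset.replicate n (h z) + Multiset.replicate n (h (z ^ 2)) := by
  induction n with
  | zero => simp
  | succ n ih =>
    have h0 : z ^ (3 * n) = 1 := by rw [pow_mul, hz, one_pow]
    rw [mul_add, mul_one, Multiset.range_succ, Multiset.range_succ, Multiset.range_succ]
    simp only [Multiset.map_cons, ih, Multiset.replicate_succ, pow_add, h0, one_mul, pow_one]
    simp only [← Multiset.singleton_add]
    abel

/-! ### The nonzero cubes through a cubic character. -/

section CubicCharacter

variable {K : Type*} [Field K] [Fintype K] {θ : MulChar K ℂ}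

omit [Fintype K] in
theorem apply_generator_ne_one (hθ : θ ≠ 1) {g : Kˣ} (hg : ∀ x, x ∈ Subgroup.zpowers g) :
    θ g ≠ 1 := fun h =>
  hθ <| (MulChar.eq_iff hg θ 1).2 <| by rw [h, MulChar.one_apply_coe]

theorem exists_pow_eq {g : Kˣ} (hg : ∀ x, x ∈ Subgroup.zpowers g) {s : K} (hs : s ≠ 0) :
    ∃ k : ℕ, s = g ^ k := by
  obtain ⟨k, hk⟩ := (mem_powers_iff_mem_zpowers.2 (hg (Units.mk0 s hs)))
  exact ⟨k, by simpa using congrArg Units.val hk.symm⟩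

omit [Fintype K] in
theorem apply_pow_three (hθ : orderOf θ = 3) {s : K} (hs : s ≠ 0) : θ s ^ 3 = 1 := by
  have hθ3 : θ ^ 3 = 1 := hθ ▸ pow_orderOf_eq_one θ
  rw [← MulChar.pow_apply' θ (by norm_num), hθ3, MulChar.one_apply hs.isUnit]

omit [Fintype K] in
theorem inv_apply_eq_sq (hθ : orderOf θ = 3) (s : K) : θ⁻¹ s = θ s ^ 2 := by
  have hθ3 : θ ^ 3 = 1 := hθ ▸ pow_orderOf_eq_one θ
  rw [← MulChar.pow_apply' θ (by norm_num), ← eq_inv_of_mul_eq_one_left (a := θ ^ 2) (b := θ)]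
  rw [← pow_succ, hθ3]

/-- The nonzero cubes are the kernel of a cubic character. -/
theorem mem_powerSet_three_iff (hθ : orderOf θ = 3) {s : K} (hs : s ≠ 0) :
    s ∈ powerSet 3 K ↔ θ s = 1 := by
  have hθ1 : θ ≠ 1 := fun h => by simp [h] at hθ
  constructor
  · rintro ⟨x, hx, rfl⟩
    rw [map_pow, apply_pow_three hθ hx]
  · intro h
    obtain ⟨g, hg⟩ := IsCyclic.exists_generator (α := Kˣ)
    obtain ⟨k, rfl⟩ := exists_pow_eq hg hs
    have ho : orderOf (θ (g : K)) = 3 :=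
      orderOf_eq_prime (apply_pow_three hθ g.ne_zero) (apply_generator_ne_one hθ1 hg)
    rw [map_pow, ← orderOf_dvd_iff_pow_eq_one, ho] at h
    obtain ⟨j, rfl⟩ := h
    exact ⟨(g : K) ^ j, pow_ne_zero _ g.ne_zero, by rw [← pow_mul, mul_comm]⟩

omit [Fintype K] in
theorem zero_notMem_powerSet {k : ℕ} : (0 : K) ∉ powerSet k K := fun ⟨_, hx, h⟩ =>
  pow_ne_zero k hx h

theorem three_mul_indicator (hθ : orderOf θ = 3) (s : K) [Decidable (s ∈ powerSet 3 K)]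
    [Decidable (s = 0)] :
    (3 * if s ∈ powerSet 3 K then 1 else 0 : ℂ) = (1 - if s = 0 then 1 else 0) + θ s + θ⁻¹ s := by
  by_cases hs : s = 0
  · subst hs
    simp [zero_notMem_powerSet, MulChar.map_zero]
  rw [if_neg hs, inv_apply_eq_sq hθ]
  have h3 := apply_pow_three hθ hs
  by_cases h : θ s = 1
  · rw [if_pos ((mem_powerSet_three_iff hθ hs).2 h), h]
    norm_num
  · rw [if_neg (mt (mem_powerSet_three_iff hθ hs).1 h)]
    have : (θ s - 1) * (1 + θ s + θ s ^ 2) = 0 := by linear_combination h3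
    linear_combination -(mul_eq_zero.1 this).resolve_left (sub_ne_zero.2 h)

theorem gaussSum_mulShift_unit (η : MulChar K ℂ) (Ψ : AddChar K ℂ) (α : Kˣ) :
    ∑ s, η s * Ψ (s * α) = η⁻¹ α * gaussSum η Ψ := by
  have h := gaussSum_mulShift η Ψ α
  have h1 : η⁻¹ α * η α = 1 := by
    rw [← MulChar.mul_apply, inv_mul_cancel, MulChar.one_apply_coe]
  rw [← h, ← mul_assoc, h1, one_mul, gaussSum]
  simp only [AddChar.mulShift_apply, mul_comm]

/-- In the expansion of the indicator, the trivial part sums to -1 over s ≠ 0, and the substitution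
s ↦ s/α turns the other two parts into Gauss sums. -/
theorem sum_cubes_apply_mul (hθ : orderOf θ = 3) {Ψ : AddChar K ℂ} (hΨ : Ψ ≠ 1) (α : Kˣ)
    [DecidablePred (· ∈ powerSet 3 K)] :
    ∑ s with s ∈ powerSet 3 K, Ψ (s * α) =
      (θ α ^ 2 * gaussSum θ Ψ + θ α * gaussSum θ⁻¹ Ψ - 1) / 3 := by
  classical
  have h : 3 * ∑ s with s ∈ powerSet 3 K, Ψ (s * α) =
      ∑ s : K, ((1 - if s = 0 then 1 else 0) + θ s + θ⁻¹ s) * Ψ (s * α) := by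
    rw [sum_filter, mul_sum]
    refine sum_congr rfl fun s _ => ?_
    rw [← three_mul_indicator hθ s]
    split_ifs <;> simp
  simp only [add_mul, sub_mul, sum_add_distrib, sum_sub_distrib, gaussSum_mulShift_unit, inv_inv,
    one_mul, ite_mul, zero_mul, sum_ite_eq', mem_univ, if_true, AddChar.map_zero_eq_one,
    AddChar.sum_mulShift (α : K) (AddChar.IsPrimitive.of_ne_one hΨ), α.ne_zero, if_false] at h
  rw [inv_apply_eq_sq hθ] at h
  push_cast at h
  linear_combination h / 3

theorem card_cubes (hθ : orderOf θ = 3) {n : ℕ} (hn : Fintype.card K = 3 * n + 1)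
    [DecidablePred (· ∈ powerSet 3 K)] : #{s : K | s ∈ powerSet 3 K} = n := by
  classical
  have hθ1 : θ ≠ 1 := fun h => by simp [h] at hθ
  have h : (3 * #{s : K | s ∈ powerSet 3 K} : ℂ) =
      ∑ s : K, ((1 - if s = 0 then 1 else 0) + θ s + θ⁻¹ s) := by
    rw [card_filter, Nat.cast_sum, mul_sum]
    refine sum_congr rfl fun s _ => ?_
    rw [← three_mul_indicator hθ s]
    split_ifs <;> simp
  rw [sum_add_distrib, sum_add_distrib, sum_sub_distrib, MulChar.sum_eq_zero_of_ne_one hθ1,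
    MulChar.sum_eq_zero_of_ne_one (inv_ne_one.2 hθ1)] at h
  simp only [sum_const, card_univ, nsmul_eq_mul, mul_one, sum_ite_eq', mem_univ, if_true, add_zero,
    hn] at h
  push_cast at h
  have h' : (#{s : K | s ∈ powerSet 3 K} : ℂ) = n := by linear_combination h / 3
  exact_mod_cast h'

/-- The spectrum of the Cayley graph of the nonzero cubes, in terms of cubic Gauss sums. -/
theorem spec_cayleyGraph_cubes (hθ : orderOf θ = 3) {Ψ : AddChar K ℂ} (hΨ : Ψ ≠ 1) {n : ℕ}
    (hn : Fintype.card K = 3 * n + 1) :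
    spec (cayleyGraph K (powerSet 3 K)) =
      Multiset.replicate 1 (n : ℂ) +
      (Multiset.replicate n ((gaussSum θ Ψ + gaussSum θ⁻¹ Ψ - 1) / 3) +
      (Multiset.replicate n ((omega * gaussSum θ Ψ + omega ^ 2 * gaussSum θ⁻¹ Ψ - 1) / 3) +
      Multiset.replicate n ((omega ^ 2 * gaussSum θ Ψ + omega * gaussSum θ⁻¹ Ψ - 1) / 3))) := by
  classical
  have hθ1 : θ ≠ 1 := fun h => by simp [h] at hθ
  obtain ⟨g, hg⟩ := IsCyclic.exists_generator (α := Kˣ)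
  have hord : orderOf g = 3 * n := by
    rw [orderOf_eq_card_of_forall_mem_zpowers hg, Nat.card_eq_fintype_card, Fintype.card_units, hn,
      Nat.add_sub_cancel]
  have huniv : (univ : Finset K).val = 0 ::ₘ (Multiset.range (3 * n)).map fun k => (g : K) ^ k := by
    have hnodup : ((Multiset.range (3 * n)).map fun k => (g : K) ^ k).Nodup := by
      refine Multiset.Nodup.map_on ?_ (Multiset.nodup_range _)
      intro a ha b hb hab
      rw [Multiset.mem_range, ← hord] at ha hb
      exact pow_injOn_Iio_orderOf ha hb (Units.ext (by simpa using hab))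
    have h0 : (0 : K) ∉ (Multiset.range (3 * n)).map fun k => (g : K) ^ k := by
      rw [Multiset.mem_map]
      rintro ⟨k, -, hk⟩
      exact pow_ne_zero k g.ne_zero hk
    refine (Multiset.Nodup.ext univ.nodup (Multiset.nodup_cons.2 ⟨h0, hnodup⟩)).2 fun s => ?_
    simp only [mem_val, mem_univ, true_iff, Multiset.mem_cons, Multiset.mem_map, Multiset.mem_range]
    refine or_iff_not_imp_left.2 fun hs => ?_
    obtain ⟨k, rfl⟩ := exists_pow_eq hg hs
    have hn0 : 0 < 3 * n := hord ▸ orderOf_pos g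
    refine ⟨k % (3 * n), Nat.mod_lt _ hn0, ?_⟩
    rw [← hord, ← Units.val_pow_eq_pow_val, ← Units.val_pow_eq_pow_val, pow_mod_orderOf]
  rw [spec_cayleyGraph (AddChar.IsPrimitive.of_ne_one hΨ), huniv, Multiset.map_cons, Multiset.map_map]
  let h : ℂ → ℂ := fun z => (z ^ 2 * gaussSum θ Ψ + z * gaussSum θ⁻¹ Ψ - 1) / 3
  have hpow : ((fun α => ∑ s with s ∈ powerSet 3 K, Ψ (s * α)) ∘ fun k => (g : K) ^ k) =
      fun k => h (θ g ^ k) := by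
    funext k
    rw [Function.comp_apply, ← Units.val_pow_eq_pow_val, sum_cubes_apply_mul hθ hΨ,
      Units.val_pow_eq_pow_val, map_pow]
  have hz3 := apply_pow_three hθ g.ne_zero
  have ho2 : omega ^ 2 * omega ^ 2 = omega := by linear_combination omega * omega_cube
  rw [hpow, map_pow_range_three_mul h hz3]
  simp only [mul_zero, AddChar.map_zero_eq_one, sum_const, nsmul_eq_mul, mul_one, card_cubes hθ hn,
    Multiset.replicate_one, ← Multiset.singleton_add]
  -- The two possible values of θ(g) only interchange the last two blocks.
  rcases eq_omega_or_sq hz3 (apply_generator_ne_one hθ1 hg) with hz | hz <;>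
    simp only [hz, h, one_pow, one_mul, pow_two (omega ^ 2), ho2] <;> abel

end CubicCharacter

/-! ### Lifting characters by the norm. -/

section NormCharacter

variable {F K : Type*} [Field F] [Field K] [Finite K] [Algebra F K]

variable (K) in
/-- The multiplicative character `χ ∘ N` of an extension of finite fields. -/
noncomputable def normMulChar (χ : MulChar F ℂ) : MulChar K ℂ where
  toMonoidHom := χ.toMonoidHom.comp (Algebra.norm F)
  map_nonunit' a ha := by
    have : a = 0 := by simpa using ha
    subst this
    have : FiniteDimensional F K := Module.Finite.of_finite
    simp [MulChar.map_zero]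

theorem normMulChar_apply (χ : MulChar F ℂ) (a : K) : normMulChar K χ a = χ (Algebra.norm F a) :=
  rfl

theorem normMulChar_inv (χ : MulChar F ℂ) : normMulChar K χ⁻¹ = (normMulChar K χ)⁻¹ := by
  ext a
  rw [MulChar.inv_apply_eq_inv', normMulChar_apply, normMulChar_apply, MulChar.inv_apply_eq_inv']

/-- The norm of finite fields is surjective, so χ ∘ N stays nontrivial. -/
theorem orderOf_normMulChar {χ : MulChar F ℂ} (hχ : orderOf χ = 3) :
    orderOf (normMulChar K χ) = 3 := by
  have hfin : FiniteDimensional F K := Module.Finite.of_finite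
  have hχ3 : χ ^ 3 = 1 := hχ ▸ pow_orderOf_eq_one χ
  refine orderOf_eq_prime ?_ ?_
  · ext a
    have hN : Algebra.norm F (a : K) ≠ 0 := Algebra.norm_ne_zero_iff.2 a.ne_zero
    rw [MulChar.pow_apply_coe, normMulChar_apply, ← MulChar.pow_apply' χ (by norm_num), hχ3,
      MulChar.one_apply hN.isUnit, MulChar.one_apply_coe]
  · intro h
    have hχ1 : χ ≠ 1 := fun h => by simp [h] at hχ
    refine hχ1 (MulChar.ext fun a => ?_)
    obtain ⟨b, hb⟩ := FiniteField.norm_surjective F K a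
    have hb0 : b ≠ 0 := fun h0 => a.ne_zero (by rw [← hb, h0, Algebra.norm_zero])
    rw [← hb, ← normMulChar_apply, h, MulChar.one_apply hb0.isUnit, hb, MulChar.one_apply_coe]

end NormCharacter

/-! ### The spectrum from one base solution. -/

theorem ne_two_of_modEq {p : ℕ} (hp : p ≡ 1 [MOD 3]) : p ≠ 2 := by
  rintro rfl
  exact absurd hp (by decide)

theorem three_mul_card_cubes_add_one {p : ℕ} [Fact p.Prime] (hp : p ≡ 1 [MOD 3]) (ℓ : ℕ) :
    3 * ((p ^ (3 * ℓ) - 1) / 3) + 1 = p ^ (3 * ℓ) := by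
  have hpos : 1 ≤ p ^ (3 * ℓ) := Nat.one_le_pow _ _ (Fact.out : p.Prime).pos
  have h3 : 3 ∣ p ^ (3 * ℓ) - 1 := by
    have : p ^ (3 * ℓ) ≡ 1 [MOD 3] := by simpa using hp.pow (3 * ℓ)
    exact (Nat.modEq_iff_dvd' hpos).1 this.symm
  rw [Nat.mul_div_cancel' h3, Nat.sub_add_cancel hpos]

/-- The spectrum of `Γ(3, p ^ (3 * ℓ))`, for one solution of `p = x ^ 2 + 27 * y ^ 2`. -/
theorem exists_spec_gpGraph (p : ℕ) [Fact p.Prime] (hp : p ≡ 1 [MOD 3]) (h2 : IsCubicResidue 2 p) :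
    ∃ x y : ℤ, IsBaseSolution p x y ∧ ∀ ℓ : ℕ, 1 ≤ ℓ →
      spec (gpGraph 3 p (3 * ℓ)) = ((cubicSpec p ℓ (aSeq x y ℓ) (bSeq x y ℓ)).map
        fun e => Multiset.replicate e.2 e.1).sum := by
  have hprime : p.Prime := Fact.out
  have hp2 : (2 : ZMod p) ≠ 0 := fun h =>
    ne_two_of_modEq hp ((Nat.prime_dvd_prime_iff_eq hprime Nat.prime_two).1
      ((ZMod.natCast_eq_zero_iff 2 p).1 (by exact_mod_cast h)))
  have h3 : 3 ∣ Fintype.card (ZMod p) - 1 := by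
    rw [ZMod.card]
    exact (Nat.modEq_iff_dvd' hprime.one_le).1 hp.symm
  obtain ⟨χ, hχ⟩ := MulChar.exists_mulChar_orderOf (ZMod p) h3 omega_isPrimitiveRoot
  have hχ2 : χ 2 = 1 := by
    obtain ⟨x, hx⟩ := h2
    have hx' : (2 : ZMod p) = (x : ZMod p) ^ 3 := by
      exact_mod_cast (ZMod.intCast_eq_intCast_iff _ _ _).2 hx
    rw [hx', map_pow, apply_pow_three hχ]
    rintro h0
    rw [h0] at hx'
    exact hp2 (by simpa using hx')
  obtain ⟨x, y, hxy, hx1, hJ, hJ'⟩ := exists_jacobiSum_eq hχ hp2 hχ2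
  rw [ZMod.card] at hxy
  refine ⟨x, y, ⟨hxy, ?_, hx1⟩, fun ℓ hℓ => ?_⟩
  · rw [Int.isCoprime_iff_gcd_eq_one, Int.gcd_comm, ← Int.isCoprime_iff_gcd_eq_one]
    refine (Nat.prime_iff_prime_int.1 hprime).coprime_iff_not_dvd.2 ?_
    -- If p ∣ x, then either x = 0 and 3 ∣ p, or p² ≤ x² ≤ p.
    rintro ⟨k, rfl⟩
    have hp1 : (1 : ℤ) < p := by exact_mod_cast hprime.one_lt
    rcases eq_or_ne k 0 with rfl | hk
    · have h27 : (p : ℤ) = 27 * y ^ 2 := by simpa using hxy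
      have : (3 : ℤ) ∣ p := ⟨9 * y ^ 2, by rw [h27]; ring⟩
      have : p % 3 = 0 := by omega
      have : p % 3 = 1 := hp
      omega
    · have : 1 ≤ k ^ 2 := Int.one_le_abs (pow_ne_zero 2 hk) |>.trans_eq (abs_of_nonneg (sq_nonneg k))
      nlinarith [sq_nonneg y, mul_le_mul_of_nonneg_left this (sq_nonneg (p : ℤ))]
  let K := GaloisField p (3 * ℓ)
  let _ : Fintype K := Fintype.ofFinite K
  have hrank : Module.finrank (ZMod p) K = 3 * ℓ := GaloisField.finrank p (by omega)
  have hcard : Fintype.card K = 3 * ((p ^ (3 * ℓ) - 1) / 3) + 1 := by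
    rw [three_mul_card_cubes_add_one hp, ← Nat.card_eq_fintype_card]
    exact GaloisField.card p _ (by omega)
  obtain ⟨ψ, hψ⟩ : ∃ ψ : AddChar (ZMod p) ℂ, ψ ≠ 1 :=
    ⟨ZMod.stdAddChar, by simpa using ZMod.isPrimitive_stdAddChar p one_ne_zero⟩
  let Ψ : AddChar K ℂ := ψ.compAddMonoidHom (Algebra.trace (ZMod p) K).toAddMonoidHom
  have hΨ : Ψ ≠ 1 := by
    obtain ⟨c, hc⟩ := AddChar.ne_one_iff.1 hψ
    obtain ⟨b, rfl⟩ := Algebra.trace_surjective (ZMod p) K c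
    exact AddChar.ne_one_iff.2 ⟨b, hc⟩
  have hG : gaussSum (normMulChar K χ) Ψ =
      -(p : ℂ) ^ ℓ * (x + 3 * (Real.sqrt 3 : ℂ) * y * Complex.I) ^ ℓ := by
    have := sum_norm_trace_of_finrank_eq_three_mul (K := K) hχ hψ hℓ hrank
    rwa [hJ, ZMod.card] at this
  have hG' : gaussSum (normMulChar K χ)⁻¹ Ψ =
      -(p : ℂ) ^ ℓ * (x - 3 * (Real.sqrt 3 : ℂ) * y * Complex.I) ^ ℓ := by
    have := sum_norm_trace_of_finrank_eq_three_mul (K := K) (χ := χ⁻¹)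
      (by rw [orderOf_inv, hχ]) hψ hℓ hrank
    rw [← normMulChar_inv]
    rwa [hJ', ZMod.card] at this
  have hspec := spec_cayleyGraph_cubes (orderOf_normMulChar (K := K) hχ) hΨ hcard
  obtain ⟨m, rfl⟩ : ∃ m, ℓ = m + 1 := ⟨ℓ - 1, by omega⟩
  have hs := sqrt_three_sq
  have hI := Complex.I_sq
  rw [gpGraph, hspec, hG, hG', omega_sq]
  simp only [cubicSpec, List.map_cons, List.map_nil, List.sum_cons, List.sum_nil, add_zero]
  -- Absorbing one more factor x ± 3√3 y i makes b_ℓ a multiple of the difference of ℓ-th powers, as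
  -- ω - ω² = √3 i requires.
  have hb : bSeq x y (m + 1) = (Real.sqrt 3 : ℂ) / 9 * Complex.I *
      ((x + 3 * (Real.sqrt 3 : ℂ) * y * Complex.I) ^ (m + 1) -
        (x - 3 * (Real.sqrt 3 : ℂ) * y * Complex.I) ^ (m + 1)) := by
    rw [bSeq, Nat.add_sub_cancel, pow_succ, pow_succ]
    generalize ((x : ℂ) + 3 * (Real.sqrt 3 : ℂ) * y * Complex.I) ^ m = U
    generalize ((x : ℂ) - 3 * (Real.sqrt 3 : ℂ) * y * Complex.I) ^ m = V
    linear_combination (-(U + V) * y / 3 * Complex.I ^ 2) * hs - (U + V) * y * hI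
  rw [hb, aSeq, omega]
  congr 4
  · ring
  · congr 1
    ring
  · congr 1
    ring

/-! ### Integrality and distinctness of the eigenvalues. -/

/-- The powers of `x + 3√3 y i` for a solution of `p = x ^ 2 + 27 * y ^ 2`. -/
theorem exists_aSeq_bSeq_eq {p : ℕ} [Fact p.Prime] (hp : p ≡ 1 [MOD 3]) {x y : ℤ}
    (h : IsBaseSolution p x y) {ℓ : ℕ} (hℓ : 1 ≤ ℓ) :
    ∃ X Y : ℤ, aSeq x y ℓ = -2 * X ∧ bSeq x y ℓ = -2 * Y ∧ X ^ 2 + 27 * Y ^ 2 = p ^ ℓ ∧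
      X ≡ 1 [ZMOD 3] ∧ Y ≠ 0 := by
  obtain ⟨hxy, hcop, hx⟩ := h
  have hprime : p.Prime := Fact.out
  have hpp : Prime (p : ℤ) := Nat.prime_iff_prime_int.1 hprime
  have hpx : ¬ (p : ℤ) ∣ x := fun hd => hpp.not_isUnit (hcop.isUnit_of_dvd' hd dvd_rfl)
  have hp2 : ¬ (p : ℤ) ∣ 2 := fun hd => ne_two_of_modEq hp
    ((Nat.prime_dvd_prime_iff_eq hprime Nat.prime_two).1 (by exact_mod_cast hd))
  have hs := sqrt_three_sq
  have hI := Complex.I_sq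
  -- The divisibility p ∣ xX + 27yY carries p ∤ X through the induction: added to the next value xX
  -- - 27yY it gives 2xX, which is prime to p.
  have key : ∃ X Y : ℤ, ((x : ℂ) + 3 * (Real.sqrt 3 : ℂ) * y * Complex.I) ^ ℓ =
        X + 3 * (Real.sqrt 3 : ℂ) * Y * Complex.I ∧
      ((x : ℂ) - 3 * (Real.sqrt 3 : ℂ) * y * Complex.I) ^ ℓ =
        X - 3 * (Real.sqrt 3 : ℂ) * Y * Complex.I ∧
      X ^ 2 + 27 * Y ^ 2 = p ^ ℓ ∧ X ≡ 1 [ZMOD 3] ∧ ¬ (p : ℤ) ∣ X ∧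
      (p : ℤ) ∣ x * X + 27 * y * Y ∧ bSeq x y ℓ = -2 * Y := by
    induction ℓ, hℓ using Nat.le_induction with
    | base =>
      refine ⟨x, y, by simp, by simp, by simp [hxy], hx, hpx, ⟨1, by rw [hxy]; ring⟩, ?_⟩
      rw [bSeq]
      simp only [Nat.sub_self, pow_zero]
      ring
    | succ ℓ hℓ ih =>
      obtain ⟨X, Y, hU, hV, hN, hX, hpX, hd, -⟩ := ih
      refine ⟨x * X - 27 * y * Y, x * Y + y * X, ?_, ?_, ?_, ?_, ?_, ⟨X, ?_⟩, ?_⟩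
      · rw [pow_succ, hU]
        push_cast
        linear_combination (9 * Y * y * Complex.I ^ 2 : ℂ) * hs + (27 * Y * y : ℂ) * hI
      · rw [pow_succ, hV]
        push_cast
        linear_combination (9 * Y * y * Complex.I ^ 2 : ℂ) * hs + (27 * Y * y : ℂ) * hI
      · rw [pow_succ (p : ℤ), ← hN, hxy]
        ring
      · have h1 : x * X ≡ 1 * 1 [ZMOD 3] := hx.mul hX
        have h2 : 27 * y * Y ≡ 0 [ZMOD 3] := (Int.modEq_zero_iff_dvd).2 ⟨9 * y * Y, by ring⟩
        simpa using h1.sub h2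
      · intro hd'
        have : (p : ℤ) ∣ 2 * (x * X) := by
          have := dvd_add hd hd'
          rwa [show x * X + 27 * y * Y + (x * X - 27 * y * Y) = 2 * (x * X) by ring] at this
        exact (hpp.dvd_or_dvd this).elim hp2 fun h => (hpp.dvd_or_dvd h).elim hpx hpX
      · rw [hxy]
        ring
      · rw [bSeq, Nat.add_sub_cancel, hU, hV]
        push_cast
        linear_combination (2 / 3 * x * Y * Complex.I ^ 2 : ℂ) * hs + (2 * x * Y : ℂ) * hI
  obtain ⟨X, Y, hU, hV, hN, hX, hpX, -, hb⟩ := key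
  refine ⟨X, Y, ?_, hb, hN, hX, ?_⟩
  · rw [aSeq, hU, hV]
    ring
  · rintro rfl
    refine hpX (hpp.dvd_of_dvd_pow (n := 2) ?_)
    rw [show X ^ 2 = (p : ℤ) ^ ℓ by rw [← hN]; ring]
    exact dvd_pow_self _ (by omega)

theorem eigenvalue_injective {p : ℕ} [Fact p.Prime] (ℓ : ℕ) :
    Function.Injective fun k : ℤ => ((k : ℂ) * (p : ℂ) ^ ℓ - 1) / 3 := by
  intro k k' h
  have hp0 : (p : ℂ) ^ ℓ ≠ 0 := pow_ne_zero _ (Nat.cast_ne_zero.2 (Fact.out : p.Prime).ne_zero)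
  have h1 : (k : ℂ) * (p : ℂ) ^ ℓ = k' * (p : ℂ) ^ ℓ := by
    simp only at h
    linear_combination 3 * h
  exact_mod_cast mul_right_cancel₀ hp0 h1

theorem map_fst_cubicSpec {p : ℕ} [Fact p.Prime] (hp : p ≡ 1 [MOD 3]) (ℓ : ℕ) (X Y : ℤ) :
    (cubicSpec p ℓ (-2 * X) (-2 * Y)).map Prod.fst =
      [((p : ℤ) ^ ℓ) ^ 2, -2 * X, X + 9 * Y, X - 9 * Y].map
        fun k : ℤ => ((k : ℂ) * (p : ℂ) ^ ℓ - 1) / 3 := by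
  have hn : (3 * (((p ^ (3 * ℓ) - 1) / 3 : ℕ) : ℂ) + 1) = (p : ℂ) ^ (3 * ℓ) := by
    exact_mod_cast three_mul_card_cubes_add_one hp ℓ
  have hpow : (p : ℂ) ^ (3 * ℓ) = ((p : ℂ) ^ ℓ) ^ 3 := by rw [← pow_mul, mul_comm]
  simp only [cubicSpec, List.map_cons, List.map_nil, List.cons.injEq, and_true]
  push_cast
  refine ⟨?_, rfl, ?_, ?_⟩
  · linear_combination hn / 3 + hpow / 3
  · ring
  · ring

/-- Modulo 9, -2X differs from X ± 9Y because 3 ∤ X, and X ± 9Y differ because Y ≠ 0; the degree is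
separated by size. -/
theorem nodup_cubicSpec {p : ℕ} [Fact p.Prime] (hp : p ≡ 1 [MOD 3]) {ℓ : ℕ} (hℓ : 1 ≤ ℓ) {X Y : ℤ}
    (hN : X ^ 2 + 27 * Y ^ 2 = p ^ ℓ) (hX : X ≡ 1 [ZMOD 3]) (hY : Y ≠ 0) :
    ((cubicSpec p ℓ (-2 * X) (-2 * Y)).map Prod.fst).Nodup := by
  rw [map_fst_cubicSpec hp]
  refine List.Nodup.map (eigenvalue_injective ℓ) ?_
  have hP : 2 ≤ (p : ℤ) ^ ℓ := by
    exact_mod_cast (Fact.out : p.Prime).two_le.trans (Nat.le_self_pow (by omega) p)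
  have hX' : X % 3 = 1 := hX
  generalize (p : ℤ) ^ ℓ = P at hN hP
  -- If P² = k, then P⁴ ≤ 4P, impossible for P ≥ 2.
  have hlarge : ∀ k : ℤ, k ^ 2 ≤ 4 * P → P ^ 2 ≠ k := by
    rintro k hk rfl
    nlinarith [mul_self_nonneg (P * P - 4), mul_le_mul hP hP (by norm_num) (by omega)]
  have h1 := hlarge (-2 * X) (by nlinarith [sq_nonneg Y])
  have h2 := hlarge (X + 9 * Y) (by nlinarith [sq_nonneg (X - 3 * Y)])
  have h3 := hlarge (X - 9 * Y) (by nlinarith [sq_nonneg (X + 3 * Y)])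
  simp only [List.nodup_cons, List.mem_cons, List.not_mem_nil, or_false, not_or, not_false_eq_true,
    List.nodup_nil, and_true]
  exact ⟨⟨h1, h2, h3⟩, ⟨by omega, by omega⟩, by omega⟩

/-! ### Uniqueness of the base solution and the closed form. -/

theorem IsBaseSolution.neg {p : ℕ} {x y : ℤ} (h : IsBaseSolution p x y) : IsBaseSolution p x (-y) :=
  ⟨by rw [h.1]; ring, h.2⟩

/-- The base solution is unique up to the sign of `y`. -/
theorem IsBaseSolution.eq_or_eq_neg {p : ℕ} [Fact p.Prime] {x y x' y' : ℤ}
    (h : IsBaseSolution p x y) (h' : IsBaseSolution p x' y') :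
    x' = x ∧ (y' = y ∨ y' = -y) := by
  have hpp : Prime (p : ℤ) := Nat.prime_iff_prime_int.1 Fact.out
  have hp0 : (0 : ℤ) < p := by exact_mod_cast (Fact.out : p.Prime).pos
  obtain ⟨hp, -, hx⟩ := h
  obtain ⟨hp', -, hx'⟩ := h'
  -- Applied to the two composition identities for p · p: there s = xy' ∓ x'y, and p divides one of
  -- these two values.
  have hsmall : ∀ t s : ℤ, t ^ 2 + 27 * s ^ 2 = p ^ 2 → (p : ℤ) ∣ s → s = 0 := by
    rintro t _ ht ⟨k, rfl⟩
    by_contra hk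
    have hk0 : k ≠ 0 := fun h => hk (by rw [h, mul_zero])
    have : 1 ≤ k ^ 2 := Int.one_le_abs (pow_ne_zero 2 hk0) |>.trans_eq (abs_of_nonneg (sq_nonneg k))
    nlinarith [sq_nonneg t, mul_pos hp0 hp0]
  have hdvd : (p : ℤ) ∣ (x * y' - x' * y) * (x * y' + x' * y) :=
    ⟨y' ^ 2 - y ^ 2, by linear_combination y ^ 2 * hp' - y' ^ 2 * hp⟩
  have hsq : (x * y') ^ 2 = (x' * y) ^ 2 := by
    rcases hpp.dvd_or_dvd hdvd with hd | hd
    · have := hsmall (x * x' + 27 * y * y') _ (by rw [sq (p : ℤ)]; nth_rw 1 [hp]; rw [hp']; ring) hd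
      rw [sub_eq_zero.1 this]
    · have := hsmall (x * x' - 27 * y * y') _ (by rw [sq (p : ℤ)]; nth_rw 1 [hp]; rw [hp']; ring) hd
      rw [eq_neg_of_add_eq_zero_left this, neg_sq]
  have hy : y' ^ 2 = y ^ 2 := by
    have : (p : ℤ) * (y' ^ 2 - y ^ 2) = 0 := by
      linear_combination y' ^ 2 * hp - y ^ 2 * hp' + hsq
    exact sub_eq_zero.1 ((mul_eq_zero.1 this).resolve_left hp0.ne')
  have hxx : x' ^ 2 = x ^ 2 := by linear_combination hp - hp' - 27 * hy
  have h1 : x % 3 = 1 := hx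
  have h2 : x' % 3 = 1 := hx'
  exact ⟨(sq_eq_sq_iff_eq_or_eq_neg.1 hxx).resolve_right (by omega), sq_eq_sq_iff_eq_or_eq_neg.1 hy⟩

theorem aSeq_neg (x y : ℤ) (ℓ : ℕ) : aSeq x (-y) ℓ = aSeq x y ℓ := by
  simp only [aSeq, Int.cast_neg, mul_neg, neg_mul, sub_neg_eq_add, ← sub_eq_add_neg]
  ring

theorem bSeq_neg (x y : ℤ) (ℓ : ℕ) : bSeq x (-y) ℓ = -bSeq x y ℓ := by
  simp only [bSeq, Int.cast_neg, mul_neg, neg_mul, sub_neg_eq_add, ← sub_eq_add_neg]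
  ring

/-- The closed form of the spectrum, for every base solution. -/
theorem IsBaseSolution.hasSpec {p : ℕ} [Fact p.Prime] (hp : p ≡ 1 [MOD 3])
    (h2 : IsCubicResidue 2 p) {x y : ℤ} (h : IsBaseSolution p x y) {ℓ : ℕ} (hℓ : 1 ≤ ℓ) :
    HasSpec (gpGraph 3 p (3 * ℓ)) (cubicSpec p ℓ (aSeq x y ℓ) (bSeq x y ℓ)) := by
  constructor
  · obtain ⟨X, Y, ha, hb, hN, hX, hY⟩ := exists_aSeq_bSeq_eq hp h hℓ
    rw [ha, hb]
    exact nodup_cubicSpec hp hℓ hN hX hY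
  · obtain ⟨x₀, y₀, h₀, hspec⟩ := exists_spec_gpGraph p hp h2
    obtain ⟨rfl, rfl | rfl⟩ := h₀.eq_or_eq_neg h
    · exact hspec ℓ hℓ
    -- Changing the sign of y swaps the last two eigenvalues, which have equal multiplicity.
    · rw [hspec ℓ hℓ, aSeq_neg, bSeq_neg]
      simp only [cubicSpec, List.map_cons, List.map_nil, List.sum_cons, List.sum_nil, add_zero,
        mul_neg, sub_neg_eq_add, ← sub_eq_add_neg]
      rw [add_comm (Multiset.replicate _ ((-(1 / 2) * (_ + _) * _ - 1) / 3))]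

/-! ### Recovering the parameters from the spectrum. -/

theorem aSeq_one (x y : ℤ) : aSeq x y 1 = -2 * x := by
  simp only [aSeq, pow_one]
  ring

theorem bSeq_one (x y : ℤ) : bSeq x y 1 = -2 * y := by
  simp only [bSeq, Nat.sub_self, pow_zero]
  ring

theorem mem_spec_iff {V : Type*} [Finite V] {Γ : Digraph V} {L : List (ℂ × ℕ)} (h : HasSpec Γ L)
    {z : ℂ} : z ∈ spec Γ ↔ ∃ e ∈ L, e.2 ≠ 0 ∧ z = e.1 := by
  rw [h.2]
  clear h
  induction L with
  | nil => simp
  | cons e L ih => simp [ih, Multiset.mem_replicate]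

theorem card_spec {V : Type*} [Finite V] (Γ : Digraph V) : (spec Γ).card = Nat.card V := by
  classical
  let _ := Fintype.ofFinite V
  rw [spec_eq_roots, IsAlgClosed.card_roots_eq_natDegree,
    Matrix.charpoly_natDegree_eq_dim,
    Nat.card_eq_fintype_card]

/-- The parameters read off from the spectrum of `Γ(3, p ^ 3)`. -/
theorem eq_of_hasSpec {p : ℕ} [Fact p.Prime] (hp : p ≡ 1 [MOD 3]) {X Y a b : ℤ}
    (hX : X ≡ 1 [ZMOD 3]) (h : HasSpec (gpGraph 3 p 3) (cubicSpec p 1 a b))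
    (h' : HasSpec (gpGraph 3 p 3) (cubicSpec p 1 (-2 * X) (-2 * Y))) :
    a = -2 * X ∧ (b = -2 * Y ∨ b = 2 * Y) := by
  have hp0 : (p : ℂ) ≠ 0 := Nat.cast_ne_zero.2 (Fact.out : p.Prime).ne_zero
  have hn : (p ^ (3 * 1) - 1) / 3 ≠ 0 := by
    have h1 := three_mul_card_cubes_add_one hp 1
    have h2 : 1 < p ^ (3 * 1) := Nat.one_lt_pow (by norm_num) (Fact.out : p.Prime).one_lt
    omega
  have hmem : ∀ e ∈ cubicSpec p 1 a b, e.2 ≠ 0 → e.1 ∈ (cubicSpec p 1 (-2 * X) (-2 * Y)).map Prod.fst := by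
    intro e he he0
    obtain ⟨e', he', -, heq⟩ := (mem_spec_iff h').1 ((mem_spec_iff h).2 ⟨e, he, he0, rfl⟩)
    exact List.mem_map.2 ⟨e', he', heq.symm⟩
  have hnodup := h.1
  have hcancel : ∀ t k : ℂ, (t * (p : ℂ) ^ 1 - 1) / 3 = (k * (p : ℂ) ^ 1 - 1) / 3 → t = k := by
    intro t k htk
    refine mul_right_cancel₀ hp0 ?_
    linear_combination 3 * htk
  simp only [cubicSpec, List.map_cons, List.map_nil, List.mem_cons, List.not_mem_nil, or_false,
    List.nodup_cons, not_or] at hnodup hmem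
  obtain ⟨⟨hn1, hn2, hn3⟩, -⟩ := hnodup
  have key : ∀ t : ℂ, ((t * (p : ℂ) ^ 1 - 1) / 3, (p ^ (3 * 1) - 1) / 3) ∈ cubicSpec p 1 a b →
      (((p ^ (3 * 1) - 1) / 3 : ℕ) : ℂ) ≠ (t * (p : ℂ) ^ 1 - 1) / 3 →
      2 * t = ((-4 * X : ℤ) : ℂ) ∨ 2 * t = ((2 * X + 18 * Y : ℤ) : ℂ) ∨
        2 * t = ((2 * X - 18 * Y : ℤ) : ℂ) := by
    intro t ht htn
    simp only [cubicSpec, List.mem_cons, List.not_mem_nil, or_false] at ht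
    rcases hmem _ ht hn with h | h | h | h
    · exact absurd h.symm htn
    · refine Or.inl ?_
      rw [hcancel _ _ h]
      push_cast
      ring
    · refine Or.inr (Or.inl ?_)
      rw [hcancel _ _ h]
      push_cast
      ring
    · refine Or.inr (Or.inr ?_)
      rw [hcancel _ _ h]
      push_cast
      ring
  -- Two eigenvalues suffice. Modulo 9, 3 ∤ X excludes a = X ± 9Y and -(a + 9b) = -4X; what remains
  -- is a = -2X and b = ±2Y.
  have h1 := key a (by simp [cubicSpec]) hn1
  have h2 := key _ (by simp [cubicSpec]) hn2
  have e1 : 2 * (a : ℂ) = ((2 * a : ℤ) : ℂ) := by push_cast; ring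
  have e2 : 2 * (-(1 / 2) * ((a : ℂ) + 9 * b)) = ((-(a + 9 * b) : ℤ) : ℂ) := by push_cast; ring
  rw [e1] at h1
  rw [e2] at h2
  simp only [Int.cast_inj] at h1 h2
  have hX' : X % 3 = 1 := hX
  omega

/-- Counted with multiplicity, the eigenvalues are as many as the vertices, namely p³. -/
theorem eq_of_spec_eq {p p' : ℕ} [Fact p.Prime] [Fact p'.Prime]
    (h : spec (gpGraph 3 p' 3) = spec (gpGraph 3 p 3)) : p' = p := by
  have hcard := congrArg Multiset.card h
  rw [card_spec, card_spec, GaloisField.card _ _ (by norm_num), GaloisField.card _ _ (by norm_num)]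
    at hcard
  exact Nat.pow_left_injective (by norm_num : 3 ≠ 0) hcard

end GenPaley

theorem theorem3p3 (p : ℕ) [Fact p.Prime] (hp : p ≡ 1 [MOD 3])
    (h2 : GenPaley.IsCubicResidue 2 p) :
    -- the spectrum of `Γ(3, p ^ 3)` determines that of `Γ(3, p ^ (3 * ℓ))`
    (∀ (p' : ℕ) [Fact p'.Prime], p' ≡ 1 [MOD 3] → GenPaley.IsCubicResidue 2 p' →
      GenPaley.spec (GenPaley.gpGraph 3 p' 3) = GenPaley.spec (GenPaley.gpGraph 3 p 3) →
      ∀ ℓ : ℕ, 1 ≤ ℓ →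
        GenPaley.spec (GenPaley.gpGraph 3 p' (3 * ℓ)) =
          GenPaley.spec (GenPaley.gpGraph 3 p (3 * ℓ))) ∧
    -- explicitly: the integers `a, b` read off from the spectrum of `Γ(3, p ^ 3)` give the
    -- solution `(x, y) = (-a/2, -b/2)`, and with it the spectrum of every `Γ(3, p ^ (3 * ℓ))`
    (∀ a b : ℤ, GenPaley.HasSpec (GenPaley.gpGraph 3 p 3) (GenPaley.cubicSpec p 1 a b) →
      ∃ x y : ℤ, a = -2 * x ∧ b = -2 * y ∧ GenPaley.IsBaseSolution p x y ∧
        ∀ ℓ : ℕ, 1 ≤ ℓ →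
          GenPaley.HasSpec (GenPaley.gpGraph 3 p (3 * ℓ))
            (GenPaley.cubicSpec p ℓ (GenPaley.aSeq x y ℓ) (GenPaley.bSeq x y ℓ))) ∧
    -- the closed form of the spectrum
    (∃ x₀ y₀ : ℤ, GenPaley.IsBaseSolution p x₀ y₀) ∧
    (∀ x₀ y₀ : ℤ, GenPaley.IsBaseSolution p x₀ y₀ → ∀ ℓ : ℕ, 1 ≤ ℓ →
      GenPaley.HasSpec (GenPaley.gpGraph 3 p (3 * ℓ))
        (GenPaley.cubicSpec p ℓ (GenPaley.aSeq x₀ y₀ ℓ) (GenPaley.bSeq x₀ y₀ ℓ))) := by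
  have hbase : ∃ x y : ℤ, GenPaley.IsBaseSolution p x y := by
    obtain ⟨x, y, h, -⟩ := GenPaley.exists_spec_gpGraph p hp h2
    exact ⟨x, y, h⟩
  refine ⟨?_, ?_, hbase, fun x₀ y₀ h ℓ hℓ => h.hasSpec hp h2 hℓ⟩
  · intro p' _ _ _ hspec ℓ _
    obtain rfl := GenPaley.eq_of_spec_eq hspec
    rfl
  · intro a b hab
    obtain ⟨x, y, h⟩ := hbase
    have h1 := h.hasSpec hp h2 le_rfl
    rw [GenPaley.aSeq_one, GenPaley.bSeq_one] at h1
    obtain ⟨ha, hb | hb⟩ := GenPaley.eq_of_hasSpec hp h.2.2 hab h1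
    · exact ⟨x, y, ha, hb, h, fun ℓ hℓ => h.hasSpec hp h2 hℓ⟩
    -- The sign of b selects which of the two base solutions is meant.
    · exact ⟨x, -y, ha, by rw [hb]; ring, h.neg, fun ℓ hℓ => h.neg.hasSpec hp h2 hℓ⟩
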